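/- Let $N\ge 1$, let $\Omega\subset\mathbb{R}^N$ be a bounded open set, and let $p>1$ and $1\le q<r<p^*$, where $p^*=\frac{Np}{N-p}$ if $p<N$ and $p^*=+\infty$ if $p\ge N$. For $\alpha\in\mathbb{R}$ define $$R_\alpha(u)=\frac{\int_\Omega|\nabla u|^p\,dx}{\left(\int_\Omega|u|^q\,dx\right)^{\frac{\alpha p}{q}}\left(\int_\Omega|u|^r\,dx\right)^{\frac{(1-\alpha)p}{r}}},\qquad u\in W_0^{1,p}(\Omega)\setminus\{0\}.$$ A function $u\in W_0^{1,p}(\Omega)\setminus\{0\}$ is called a critical point of $R_\alpha$ if $R_\alpha$ is Fréchet differentiable at $u$ (as a functional on $W_0^{1,p}(\Omega)$) and $R_\alpha'(u)=0$. Let $\alpha_1,\alpha_2\in\mathbb{R}$ with $\alpha_1\neq\alpha_2$. Then no $u\in W_0^{1,p}(\Omega)\setminus\{0\}$ is a critical point of both $R_{\alpha_1}$ and $R_{\alpha_2}$. Equivalently, if $u_1$ is a critical point of $R_{\alpha_1}$ and $u_2$ is a critical point of $R_{\alpha_2}$, then $u_1$ and $u_2$ are linearly independent. -/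

import Mathlib

open MeasureTheory
open scoped ContDiff

noncomputable section

namespace Rayleigh

/-- The exponent `p : ℝ`, `p > 1`, is an admissible exponent for the normed spaces `Lp`. -/
instance fact_one_le_ofReal (p : ℝ) [hp : Fact (1 < p)] : Fact (1 ≤ ENNReal.ofReal p) :=
  ⟨by simpa using ENNReal.ofReal_le_ofReal hp.out.le⟩

/-- Pairs (function, vector field) in `L^p(Ω) × L^p(Ω; ℝ^N)`. The norm is the maximum of the two
`L^p` norms, so on pairs `(u, ∇u)` it is equivalent to the usual norm of `W^{1,p}(Ω)`. -/
abbrev LpPair (N : ℕ) (p : ℝ) (Ω : Set (EuclideanSpace ℝ (Fin N))) : Type :=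
  Lp ℝ (ENNReal.ofReal p) (volume.restrict Ω) ×
    Lp (EuclideanSpace ℝ (Fin N)) (ENNReal.ofReal p) (volume.restrict Ω)

/-- The linear space of the pairs `(φ, ∇φ)` with `φ ∈ C_c^∞(Ω)`. -/
def testPairs (N : ℕ) (p : ℝ) (Ω : Set (EuclideanSpace ℝ (Fin N))) :
    Submodule ℝ (LpPair N p Ω) where
  carrier := {w | ∃ φ : EuclideanSpace ℝ (Fin N) → ℝ, ContDiff ℝ ∞ φ ∧ HasCompactSupport φ ∧
    tsupport φ ⊆ Ω ∧ w.1 =ᵐ[volume.restrict Ω] φ ∧ w.2 =ᵐ[volume.restrict Ω] gradient φ}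
  zero_mem' := by
    refine ⟨fun _ => 0, contDiff_const, HasCompactSupport.zero, by simp [tsupport], ?_, ?_⟩
    · exact Lp.coeFn_zero _ _ _
    · have h : gradient (fun _ : EuclideanSpace ℝ (Fin N) => (0 : ℝ)) = 0 := by
        funext x; simp [gradient]
      rw [h]
      exact Lp.coeFn_zero _ _ _
  add_mem' := by
    rintro v w ⟨φ, hφ, hφc, hφs, hv1, hv2⟩ ⟨ψ, hψ, hψc, hψs, hw1, hw2⟩
    refine ⟨φ + ψ, hφ.add hψ, hφc.add hψc,
      (tsupport_add φ ψ).trans (Set.union_subset hφs hψs), ?_, ?_⟩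
    · exact (Lp.coeFn_add v.1 w.1).trans (hv1.add hw1)
    · have h : gradient (φ + ψ) = gradient φ + gradient ψ := by
        funext x
        simp only [gradient, Pi.add_apply]
        rw [fderiv_add (hφ.differentiable (by simp) x) (hψ.differentiable (by simp) x), map_add]
      rw [h]
      exact (Lp.coeFn_add v.2 w.2).trans (hv2.add hw2)
  smul_mem' := by
    rintro c w ⟨φ, hφ, hφc, hφs, hw1, hw2⟩
    refine ⟨c • φ, hφ.const_smul c, hφc.smul_left (f := fun _ => c),
      (tsupport_smul_subset_right (fun _ => c) φ).trans hφs, ?_, ?_⟩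
    · exact (Lp.coeFn_smul c w.1).trans (hw1.const_smul c)
    · have h : gradient (c • φ) = c • gradient φ := by
        funext x
        simp only [gradient, Pi.smul_apply]
        rw [fderiv_const_smul (hφ.differentiable (by simp) x) c]
        simp
      rw [h]
      exact (Lp.coeFn_smul c w.2).trans (hw2.const_smul c)

/-- The Sobolev space `W_0^{1,p}(Ω)`: the closure of `C_c^∞(Ω)` in the norm of `W^{1,p}(Ω)`.
An element is stored as the pair `(u, ∇u)` of the function and its weak gradient; the second
component is determined by the first. -/
def sobolevZero (N : ℕ) (p : ℝ) [Fact (1 < p)] (Ω : Set (EuclideanSpace ℝ (Fin N))) :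
    Submodule ℝ (LpPair N p Ω) :=
  (testPairs N p Ω).topologicalClosure

variable {N : ℕ} {p : ℝ} [Fact (1 < p)] {Ω : Set (EuclideanSpace ℝ (Fin N))}

/-- The Rayleigh quotient
`R_α(u) = ∫_Ω |∇u|^p / ((∫_Ω |u|^q)^(αp/q) (∫_Ω |u|^r)^((1-α)p/r))` for `u ∈ W_0^{1,p}(Ω)`
(only its values at `u ≠ 0` are meaningful). -/
def rayleighQuotient (q r α : ℝ) (u : sobolevZero N p Ω) : ℝ :=
  (∫ x in Ω, ‖u.1.2 x‖ ^ p) /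
    ((∫ x in Ω, |u.1.1 x| ^ q) ^ (α * p / q) * (∫ x in Ω, |u.1.1 x| ^ r) ^ ((1 - α) * p / r))

/-- `u` is a critical point of `R_α`: `u ∈ W_0^{1,p}(Ω) ∖ {0}` and `R_α'(u) = 0`, the derivative
being the Fréchet derivative on `W_0^{1,p}(Ω)`. -/
def IsCriticalPoint (q r α : ℝ) (u : sobolevZero N p Ω) : Prop :=
  u ≠ 0 ∧ HasFDerivAt (rayleighQuotient q r α) (0 : sobolevZero N p Ω →L[ℝ] ℝ) u

end Rayleigh

end

/-!
The quotient `R_α₁ / R_α₂` is a power of `‖u‖_q / ‖u‖_r`, so a common critical point `u ≠ 0` of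
`R_α₁` and `R_α₂` is a critical point of `log (‖u‖_q / ‖u‖_r)`. The Euler–Lagrange equation of this
functional contains no gradient: it reads `|u|^(q-2) u / ∫ |u|^q = |u|^(r-2) u / ∫ |u|^r` almost
everywhere, so `|u|` takes only the values `0` and `c = (∫ |u|^r / ∫ |u|^q)^(1/(r-q))`. A Sobolev
function with values in `{0, c, -c}` has zero gradient, by the chain rule for `sin (2π u / c)`, and
then `u = 0` by the Sobolev–Poincaré inequality.
-/

namespace Rayleigh

open Filter Topology Module
open scoped ENNReal NNReal

lemma exists_eLpNorm_le_mul_eLpNorm_of_exponent_le {X E : Type*} [MeasurableSpace X]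
    [NormedAddCommGroup E] {μ : Measure X} {Ω : Set X} (hΩ : μ Ω ≠ ⊤) {s t : ℝ≥0∞} (hs : s ≠ 0)
    (hst : s ≤ t) :
    ∃ C : ℝ≥0, ∀ f : X → E, AEStronglyMeasurable f μ → Function.support f ⊆ Ω →
      eLpNorm f s μ ≤ C * eLpNorm f t μ := by
  have h_exp : 0 ≤ 1 / s.toReal - 1 / t.toReal := by
    rcases eq_or_ne t ⊤ with rfl | ht
    · simp
    · exact sub_nonneg.2 (one_div_le_one_div_of_le
        (ENNReal.toReal_pos hs (hst.trans_lt ht.lt_top).ne) (ENNReal.toReal_mono ht hst))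
  have h_fin : μ Ω ^ (1 / s.toReal - 1 / t.toReal) ≠ ⊤ := ENNReal.rpow_ne_top_of_nonneg h_exp hΩ
  refine ⟨(μ Ω ^ (1 / s.toReal - 1 / t.toReal)).toNNReal, fun f hf hfΩ ↦ ?_⟩
  have h := eLpNorm_le_eLpNorm_mul_rpow_measure_univ (μ := μ.restrict Ω) hst hf.restrict
  rw [Measure.restrict_apply_univ, eLpNorm_restrict_eq_of_support_subset hfΩ,
    eLpNorm_restrict_eq_of_support_subset hfΩ] at h
  rwa [ENNReal.coe_toNNReal h_fin, mul_comm]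

section Sobolev

variable {E F : Type*} [NormedAddCommGroup E] [InnerProductSpace ℝ E] [FiniteDimensional ℝ E]
  [MeasurableSpace E] [BorelSpace E] [NormedAddCommGroup F] [NormedSpace ℝ F]

lemma enorm_le_eLpNorm_one_fderiv [CompleteSpace F] (hE : finrank ℝ E = 1) {φ : E → F}
    (hφ : ContDiff ℝ 1 φ) (hφc : HasCompactSupport φ) (x : E) :
    ‖φ x‖ₑ ≤ eLpNorm (fderiv ℝ φ) 1 volume := by
  let e : E ≃ₗᵢ[ℝ] ℝ :=
    (stdOrthonormalBasis ℝ E).equiv (stdOrthonormalBasis ℝ ℝ) (finCongr (by simp [hE]))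
  have h_deriv (y : ℝ) : deriv (φ ∘ e.symm) y = fderiv ℝ φ (e.symm y) (e.symm 1) := by
    rw [← fderiv_apply_one_eq_deriv, fderiv_comp y (hφ.differentiable one_ne_zero _)
      e.symm.differentiableAt, LinearIsometryEquiv.fderiv]
    rfl
  calc ‖φ x‖ₑ = ‖(φ ∘ e.symm) (e x)‖ₑ := by simp
    _ ≤ ∫⁻ y in Set.Iic (e x), ‖deriv (φ ∘ e.symm) y‖ₑ :=
      (hφc.comp_homeomorph e.symm.toHomeomorph).enorm_le_lintegral_Ici_deriv
        (hφ.comp e.symm.contDiff) _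
    _ ≤ ∫⁻ y, ‖deriv (φ ∘ e.symm) y‖ₑ := setLIntegral_le_lintegral _ _
    _ ≤ ∫⁻ y, ‖fderiv ℝ φ (e.symm y)‖ₑ := lintegral_mono fun y ↦ by
      rw [h_deriv]
      exact (ContinuousLinearMap.le_opENorm _ _).trans (by simp [enorm_eq_nnnorm])
    _ = eLpNorm (fderiv ℝ φ) 1 volume := by
      rw [eLpNorm_one_eq_lintegral_enorm,
        ← e.symm.measurePreserving.lintegral_comp_emb e.symm.toHomeomorph.measurableEmbedding]

lemma exists_eLpNorm_le_eLpNorm_fderiv_of_inv_eq [FiniteDimensional ℝ F] (hE : 0 < finrank ℝ E)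
    {s t : ℝ} (hs : 1 ≤ s) (ht : 0 ≤ t)
    (hst : t⁻¹ = s⁻¹ - (finrank ℝ E : ℝ)⁻¹) :
    ∃ C : ℝ≥0, ∀ φ : E → F, ContDiff ℝ 1 φ → HasCompactSupport φ →
      eLpNorm φ (.ofReal t) volume ≤ C * eLpNorm (fderiv ℝ φ) (.ofReal s) volume := by
  lift s to ℝ≥0 using zero_le_one.trans hs
  lift t to ℝ≥0 using ht
  simp only [ENNReal.ofReal_coe_nnreal]
  exact ⟨_, fun φ hφ hφc ↦ eLpNorm_le_eLpNorm_fderiv_of_eq volume hφ hφc (by exact_mod_cast hs)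
    hE hst⟩

lemma exists_inv_eq_inv_sub_inv {n p r : ℝ} (hn : 1 < n) (hp : 1 ≤ p)
    (hr : p < n → r ≤ n * p / (n - p)) :
    ∃ s t : ℝ, 1 ≤ s ∧ s ≤ p ∧ 0 ≤ t ∧ r ≤ t ∧ t⁻¹ = s⁻¹ - n⁻¹ := by
  by_cases hpn : p < n
  · have : 0 < n - p := sub_pos.2 hpn
    exact ⟨p, n * p / (n - p), hp, le_rfl, by positivity, hr hpn, by field_simp⟩
  · have hn1 : 0 < n - 1 := sub_pos.2 hn
    set t := max r (n / (n - 1))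
    have ht : n / (n - 1) ≤ t := le_max_right _ _
    have ht0 : 0 < t := (by positivity : 0 < n / (n - 1)).trans_le ht
    rw [div_le_iff₀ hn1] at ht
    refine ⟨n * t / (n + t), t, ?_, ?_, ht0.le, le_max_left _ _, by field_simp; ring⟩
    · rw [one_le_div (by positivity)]
      linarith
    · rw [div_le_iff₀ (by positivity)]
      nlinarith

-- For `p ≥ n` with `n = finrank ℝ E > 1` the exponent `s < n` is chosen such that its Sobolev
-- conjugate exceeds `r`.
lemma exists_eLpNorm_le_eLpNorm_fderiv [FiniteDimensional ℝ F] (hE : 0 < finrank ℝ E) {p r : ℝ}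
    (hp : 1 ≤ p) (hr : p < finrank ℝ E → r ≤ finrank ℝ E * p / (finrank ℝ E - p)) :
    ∃ s t : ℝ≥0∞, 1 ≤ s ∧ s ≤ .ofReal p ∧ .ofReal r ≤ t ∧ ∃ C : ℝ≥0, ∀ φ : E → F,
      ContDiff ℝ 1 φ → HasCompactSupport φ →
      eLpNorm φ t volume ≤ C * eLpNorm (fderiv ℝ φ) s volume := by
  have := FiniteDimensional.complete ℝ F
  rcases (Nat.one_le_iff_ne_zero.2 hE.ne').eq_or_lt' with hE1 | hE1
  · refine ⟨1, ⊤, le_rfl, by simpa using hp, le_top, 1, fun φ hφ hφc ↦ ?_⟩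
    simpa [eLpNorm_exponent_top] using eLpNormEssSup_le_of_ae_enorm_bound
      (.of_forall (enorm_le_eLpNorm_one_fderiv hE1 hφ hφc))
  · obtain ⟨s, t, hs, hsp, ht, hrt, hst⟩ :=
      exists_inv_eq_inv_sub_inv (by exact_mod_cast hE1) hp hr
    exact ⟨.ofReal s, .ofReal t, ENNReal.one_le_ofReal.2 hs, ENNReal.ofReal_le_ofReal hsp,
      ENNReal.ofReal_le_ofReal hrt,
      exists_eLpNorm_le_eLpNorm_fderiv_of_inv_eq hE hs ht hst⟩

lemma exists_eLpNorm_le_eLpNorm_fderiv_of_tsupport_subset [FiniteDimensional ℝ F]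
    (hE : 0 < finrank ℝ E) {p r : ℝ} (hp : 1 ≤ p) (hr0 : 0 < r)
    (hr : p < finrank ℝ E → r ≤ finrank ℝ E * p / (finrank ℝ E - p)) {Ω : Set E}
    (hΩ : volume Ω ≠ ⊤) :
    ∃ C : ℝ≥0, ∀ φ : E → F, ContDiff ℝ 1 φ → HasCompactSupport φ → tsupport φ ⊆ Ω →
      eLpNorm φ (.ofReal r) volume ≤ C * eLpNorm (fderiv ℝ φ) (.ofReal p) volume := by
  obtain ⟨s, t, hs, hsp, hrt, C, hC⟩ := exists_eLpNorm_le_eLpNorm_fderiv (F := F) hE hp hr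
  obtain ⟨C₁, hC₁⟩ := exists_eLpNorm_le_mul_eLpNorm_of_exponent_le (E := F) hΩ
    (ENNReal.ofReal_pos.2 hr0).ne' hrt
  obtain ⟨C₂, hC₂⟩ := exists_eLpNorm_le_mul_eLpNorm_of_exponent_le (E := E →L[ℝ] F) hΩ
    (zero_lt_one.trans_le hs).ne' hsp
  refine ⟨C₁ * C * C₂, fun φ hφ hφc hφΩ ↦ ?_⟩
  calc eLpNorm φ (.ofReal r) volume
      ≤ C₁ * eLpNorm φ t volume :=
        hC₁ φ hφ.continuous.aestronglyMeasurable ((subset_tsupport φ).trans hφΩ)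
    _ ≤ C₁ * (C * eLpNorm (fderiv ℝ φ) s volume) := by gcongr; exact hC φ hφ hφc
    _ ≤ C₁ * (C * (C₂ * eLpNorm (fderiv ℝ φ) (.ofReal p) volume)) := by
      gcongr
      exact hC₂ _ (hφ.continuous_fderiv one_ne_zero).aestronglyMeasurable
        ((support_fderiv_subset ℝ).trans hφΩ)
    _ = ↑(C₁ * C * C₂) * eLpNorm (fderiv ℝ φ) (.ofReal p) volume := by
      push_cast
      ring

end Sobolev

section Gradient

variable {E : Type*} [NormedAddCommGroup E] [InnerProductSpace ℝ E] [CompleteSpace E]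
  {φ : E → ℝ}

lemma enorm_gradient (φ : E → ℝ) (x : E) : ‖gradient φ x‖ₑ = ‖fderiv ℝ φ x‖ₑ :=
  LinearIsometryEquiv.enorm_map _ _

lemma continuous_gradient (hφ : ContDiff ℝ 1 φ) : Continuous (gradient φ) :=
  (LinearIsometryEquiv.continuous _).comp (hφ.continuous_fderiv one_ne_zero)

lemma support_gradient_subset (φ : E → ℝ) : Function.support (gradient φ) ⊆ tsupport φ :=
  fun _ hx ↦ support_fderiv_subset ℝ fun h ↦ hx (by simp [gradient, h])

lemma hasCompactSupport_gradient (hφ : HasCompactSupport φ) : HasCompactSupport (gradient φ) :=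
  hφ.mono' (support_gradient_subset φ)

lemma gradient_comp {F : ℝ → ℝ} {x : E} (hF : DifferentiableAt ℝ F (φ x))
    (hφ : DifferentiableAt ℝ φ x) :
    gradient (F ∘ φ) x = deriv F (φ x) • gradient φ x := by
  rw [gradient, (hF.hasDerivAt.comp_hasFDerivAt x hφ.hasFDerivAt).fderiv, map_smul, gradient]

end Gradient

/-- The set `C_c^∞(Ω)` of test functions on `Ω`, extended by zero to the whole space. -/
structure IsTestFunction {E : Type*} [NormedAddCommGroup E] [NormedSpace ℝ E] (Ω : Set E)
    (φ : E → ℝ) : Prop where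
  contDiff : ContDiff ℝ ∞ φ
  hasCompactSupport : HasCompactSupport φ
  tsupport_subset : tsupport φ ⊆ Ω

namespace IsTestFunction

variable {E : Type*} [NormedAddCommGroup E] [InnerProductSpace ℝ E]
  {Ω : Set E} {φ : E → ℝ}

lemma continuous (hφ : IsTestFunction Ω φ) : Continuous φ :=
  hφ.contDiff.continuous

lemma eq_zero_of_notMem (hφ : IsTestFunction Ω φ) {x : E} (hx : x ∉ Ω) : φ x = 0 :=
  image_eq_zero_of_notMem_tsupport fun h ↦ hx (hφ.tsupport_subset h)

section gradient

variable [CompleteSpace E]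

lemma continuous_gradient (hφ : IsTestFunction Ω φ) : Continuous (gradient φ) :=
  Rayleigh.continuous_gradient (hφ.contDiff.of_le (by simp))

lemma hasCompactSupport_gradient (hφ : IsTestFunction Ω φ) : HasCompactSupport (gradient φ) :=
  Rayleigh.hasCompactSupport_gradient hφ.hasCompactSupport

lemma gradient_eq_zero_of_notMem (hφ : IsTestFunction Ω φ) {x : E} (hx : x ∉ Ω) :
    gradient φ x = 0 := by
  by_contra h
  exact hx (hφ.tsupport_subset (support_gradient_subset φ h))

end gradient

section measure

variable [MeasurableSpace E] [BorelSpace E] {μ : Measure E} [IsFiniteMeasureOnCompacts μ]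

lemma memLp (hφ : IsTestFunction Ω φ) (p : ℝ≥0∞) : MemLp φ p μ :=
  hφ.continuous.memLp_of_hasCompactSupport hφ.hasCompactSupport

lemma memLp_gradient [CompleteSpace E] (hφ : IsTestFunction Ω φ) (p : ℝ≥0∞) :
    MemLp (gradient φ) p μ :=
  hφ.continuous_gradient.memLp_of_hasCompactSupport hφ.hasCompactSupport_gradient

end measure

end IsTestFunction

section SobolevZero

variable {N : ℕ} {p : ℝ} [Fact (1 < p)] {Ω : Set (EuclideanSpace ℝ (Fin N))}

lemma IsTestFunction.exists_sobolevZero {φ : EuclideanSpace ℝ (Fin N) → ℝ}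
    (hφ : IsTestFunction Ω φ) : ∃ w : sobolevZero N p Ω, w.1.1 =ᵐ[volume.restrict Ω] φ := by
  have h₁ : MemLp φ (.ofReal p) (volume.restrict Ω) := hφ.memLp _
  have h₂ : MemLp (gradient φ) (.ofReal p) (volume.restrict Ω) := hφ.memLp_gradient _
  exact ⟨⟨(h₁.toLp, h₂.toLp), (testPairs N p Ω).le_topologicalClosure
    ⟨φ, hφ.contDiff, hφ.hasCompactSupport, hφ.tsupport_subset, h₁.coeFn_toLp, h₂.coeFn_toLp⟩⟩,
    h₁.coeFn_toLp⟩

lemma exists_seq_isTestFunction_tendsto (u : sobolevZero N p Ω) :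
    ∃ φ : ℕ → EuclideanSpace ℝ (Fin N) → ℝ, (∀ n, IsTestFunction Ω (φ n)) ∧
      Tendsto (fun n ↦ eLpNorm (φ n - ⇑u.1.1) (.ofReal p) (volume.restrict Ω)) atTop (𝓝 0) ∧
      Tendsto (fun n ↦ eLpNorm (gradient (φ n) - ⇑u.1.2) (.ofReal p) (volume.restrict Ω)) atTop
        (𝓝 0) ∧
      ∀ᵐ x ∂volume.restrict Ω, Tendsto (fun n ↦ φ n x) atTop (𝓝 (u.1.1 x)) := by
  obtain ⟨w, hw, hwu⟩ := mem_closure_iff_seq_limit.1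
    (show u.1 ∈ closure (testPairs N p Ω : Set (LpPair N p Ω)) from u.2)
  have h₁ : Tendsto (fun n ↦ (w n).1) atTop (𝓝 u.1.1) := (continuous_fst.tendsto _).comp hwu
  have h₂ : Tendsto (fun n ↦ (w n).2) atTop (𝓝 u.1.2) := (continuous_snd.tendsto _).comp hwu
  obtain ⟨k, hk, h_ae⟩ := (tendstoInMeasure_of_tendsto_Lp h₁).exists_seq_tendsto_ae
  choose φ hφ hφc hφΩ hwφ hwgrad using hw
  refine ⟨φ ∘ k, fun n ↦ ⟨hφ _, hφc _, hφΩ _⟩, ?_, ?_, ?_⟩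
  · exact ((Lp.tendsto_Lp_iff_tendsto_eLpNorm' _ _).1 (h₁.comp hk.tendsto_atTop)).congr fun n ↦
      eLpNorm_congr_ae ((hwφ (k n)).sub .rfl)
  · exact ((Lp.tendsto_Lp_iff_tendsto_eLpNorm' _ _).1 (h₂.comp hk.tendsto_atTop)).congr fun n ↦
      eLpNorm_congr_ae ((hwgrad (k n)).sub .rfl)
  · filter_upwards [h_ae, ae_all_iff.2 hwφ] with x hx hwx
    simpa only [Function.comp_apply, hwx] using hx

lemma exists_eLpNorm_le_eLpNorm_gradient (hN : 0 < N) {r : ℝ} (hr0 : 0 < r)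
    (hr : p < N → r ≤ N * p / (N - p)) (hΩ : volume Ω ≠ ⊤) :
    ∃ C : ℝ≥0, ∀ φ, IsTestFunction Ω φ → eLpNorm φ (.ofReal r) (volume.restrict Ω) ≤
      C * eLpNorm (gradient φ) (.ofReal p) (volume.restrict Ω) := by
  obtain ⟨C, hC⟩ := exists_eLpNorm_le_eLpNorm_fderiv_of_tsupport_subset
    (E := EuclideanSpace ℝ (Fin N)) (F := ℝ) (by simpa) (Fact.out : 1 < p).le hr0 (by simpa) hΩ
  refine ⟨C, fun φ hφ ↦ ?_⟩
  rw [eLpNorm_restrict_eq_of_support_subset ((subset_tsupport _).trans hφ.tsupport_subset),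
    eLpNorm_restrict_eq_of_support_subset ((support_gradient_subset _).trans hφ.tsupport_subset),
    eLpNorm_congr_enorm_ae (.of_forall (enorm_gradient φ))]
  exact hC φ (hφ.contDiff.of_le (by simp)) hφ.hasCompactSupport hφ.tsupport_subset

lemma exists_eLpNorm_fst_le_eLpNorm_snd (hN : 0 < N) {r : ℝ} (hr0 : 0 < r)
    (hr : p < N → r ≤ N * p / (N - p)) (hΩ : volume Ω ≠ ⊤) :
    ∃ C : ℝ≥0, ∀ u : sobolevZero N p Ω, eLpNorm u.1.1 (.ofReal r) (volume.restrict Ω) ≤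
      C * eLpNorm u.1.2 (.ofReal p) (volume.restrict Ω) := by
  obtain ⟨C, hC⟩ := exists_eLpNorm_le_eLpNorm_gradient (p := p) hN hr0 hr hΩ
  refine ⟨C, fun u ↦ ?_⟩
  obtain ⟨φ, hφ, -, h_grad, h_ae⟩ := exists_seq_isTestFunction_tendsto u
  set G := eLpNorm u.1.2 (.ofReal p) (volume.restrict Ω)
  let d (n : ℕ) := eLpNorm (gradient (φ n) - ⇑u.1.2) (.ofReal p) (volume.restrict Ω)
  have h_lim : Tendsto (fun n ↦ C * (d n + G)) atTop (𝓝 (C * G)) := by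
    simpa using ENNReal.Tendsto.const_mul (h_grad.add_const G) (.inr (ENNReal.coe_ne_top (r := C)))
  have h_grad_le (n : ℕ) : eLpNorm (gradient (φ n)) (.ofReal p) (volume.restrict Ω) ≤ d n + G := by
    simpa only [sub_add_cancel] using eLpNorm_add_le
      ((hφ n).continuous_gradient.aestronglyMeasurable.sub (Lp.aestronglyMeasurable u.1.2))
      (Lp.aestronglyMeasurable u.1.2) (Fact.out : 1 ≤ ENNReal.ofReal p)
  calc eLpNorm u.1.1 (.ofReal r) (volume.restrict Ω)
      ≤ liminf (fun n ↦ eLpNorm (φ n) (.ofReal r) (volume.restrict Ω)) atTop :=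
        Lp.eLpNorm_lim_le_liminf_eLpNorm (fun n ↦ (hφ n).continuous.aestronglyMeasurable) _ h_ae
    _ ≤ liminf (fun n ↦ C * (d n + G)) atTop :=
        liminf_le_liminf (.of_forall fun n ↦ (hC _ (hφ n)).trans (by gcongr; exact h_grad_le n))
    _ = C * G := h_lim.liminf_eq

lemma memLp_fst (hN : 0 < N) {r : ℝ} (hr0 : 0 < r) (hr : p < N → r ≤ N * p / (N - p))
    (hΩ : volume Ω ≠ ⊤) (u : sobolevZero N p Ω) :
    MemLp u.1.1 (.ofReal r) (volume.restrict Ω) := by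
  obtain ⟨C, hC⟩ := exists_eLpNorm_fst_le_eLpNorm_snd (p := p) hN hr0 hr hΩ
  exact ⟨Lp.aestronglyMeasurable _,
    (hC u).trans_lt (ENNReal.mul_lt_top ENNReal.coe_lt_top (Lp.memLp u.1.2).eLpNorm_lt_top)⟩

lemma eq_zero_of_snd_eq_zero (hN : 0 < N) (hΩ : volume Ω ≠ ⊤) {u : sobolevZero N p Ω}
    (hu : u.1.2 = 0) : u = 0 := by
  have hp : 0 < p := zero_lt_one.trans Fact.out
  obtain ⟨C, hC⟩ := exists_eLpNorm_fst_le_eLpNorm_snd (p := p) (r := p) hN hp (fun hpN ↦ by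
    rw [le_div_iff₀ (sub_pos.2 hpN)]
    nlinarith) hΩ
  have h_fst : ‖u.1.1‖ₑ ≤ C * ‖u.1.2‖ₑ := by simpa only [Lp.enorm_def] using hC u
  rw [hu, enorm_zero, mul_zero, nonpos_iff_eq_zero, enorm_eq_zero] at h_fst
  exact Subtype.ext (Prod.ext h_fst hu)

end SobolevZero

section WeakGradient

variable {E : Type*} [NormedAddCommGroup E] [InnerProductSpace ℝ E] [CompleteSpace E]
  [FiniteDimensional ℝ E] [MeasurableSpace E] [BorelSpace E] {Ω : Set E}

/-- `g` is the distributional gradient of `f` on `Ω`. Both integrals are defined for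
`f` and `g` locally integrable on `Ω`; the definition does not include this. -/
def HasWeakGradient (Ω : Set E) (f : E → ℝ) (g : E → E) : Prop :=
  ∀ ψ, IsTestFunction Ω ψ → ∫ x in Ω, f x • gradient ψ x = -∫ x in Ω, ψ x • g x

omit [CompleteSpace E] in
lemma ae_eq_zero_of_forall_integral_smul_eq_zero {F : Type*} [NormedAddCommGroup F]
    [NormedSpace ℝ F] [CompleteSpace F] {g : E → F} (hΩ : IsOpen Ω)
    (hg : LocallyIntegrable g (volume.restrict Ω))
    (h : ∀ ψ, IsTestFunction Ω ψ → ∫ x in Ω, ψ x • g x = 0) : g =ᵐ[volume.restrict Ω] 0 := by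
  filter_upwards [hΩ.ae_eq_zero_of_integral_contDiff_smul_eq_zero (hg.locallyIntegrableOn Ω)
    fun ψ hψ hψc hψΩ ↦ h ψ ⟨hψ, hψc, hψΩ⟩, ae_restrict_mem hΩ.measurableSet] with x hx hxΩ
  exact hx hxΩ

lemma HasWeakGradient.ae_eq_zero {f : E → ℝ} {g : E → E} (hΩ : IsOpen Ω)
    (hg : LocallyIntegrable g (volume.restrict Ω)) (hfg : HasWeakGradient Ω f g)
    (hf : f =ᵐ[volume.restrict Ω] 0) : g =ᵐ[volume.restrict Ω] 0 :=
  ae_eq_zero_of_forall_integral_smul_eq_zero hΩ hg fun ψ hψ ↦ by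
    rw [← neg_eq_zero, ← hfg ψ hψ]
    exact integral_eq_zero_of_ae (hf.mono fun x hx ↦ by simp [hx])

lemma hasWeakGradient_gradient {φ : E → ℝ} (hφ : ContDiff ℝ 1 φ) :
    HasWeakGradient Ω φ (gradient φ) := by
  intro ψ hψ
  have hψ₁ : ContDiff ℝ 1 ψ := hψ.contDiff.of_le (by simp)
  have h_int₁ : Integrable (fun x ↦ φ x • gradient ψ x) volume :=
    (hφ.continuous.smul hψ.continuous_gradient).integrable_of_hasCompactSupport
      hψ.hasCompactSupport_gradient.smul_left
  have h_int₂ : Integrable (fun x ↦ ψ x • gradient φ x) volume :=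
    (hψ.continuous.smul (continuous_gradient hφ)).integrable_of_hasCompactSupport
      hψ.hasCompactSupport.smul_right
  have h_int₃ : Integrable (fun x ↦ φ x * ψ x) volume :=
    (hφ.continuous.mul hψ.continuous).integrable_of_hasCompactSupport
      hψ.hasCompactSupport.mul_left
  rw [setIntegral_eq_integral_of_forall_compl_eq_zero
      fun x hx ↦ by rw [hψ.gradient_eq_zero_of_notMem hx, smul_zero],
    setIntegral_eq_integral_of_forall_compl_eq_zero
      fun x hx ↦ by rw [hψ.eq_zero_of_notMem hx, zero_smul]]
  refine ext_inner_left ℝ fun v ↦ ?_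
  have h_parts := integral_mul_fderiv_eq_neg_fderiv_mul_of_integrable (μ := volume) (v := v)
    (f := φ) (g := ψ)
    (by simpa [inner_smul_right, inner_gradient_right, mul_comm] using
      h_int₂.const_inner (𝕜 := ℝ) v)
    (by simpa [inner_smul_right, inner_gradient_right] using h_int₁.const_inner (𝕜 := ℝ) v)
    h_int₃ (fun x _ ↦ hφ.differentiable one_ne_zero x) (fun x _ ↦ hψ₁.differentiable one_ne_zero x)
  rw [inner_neg_right, ← integral_inner h_int₁, ← integral_inner h_int₂]
  simpa [inner_smul_right, inner_gradient_right, mul_comm] using h_parts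

end WeakGradient

section Convergence

variable {X E F G : Type*} [MeasurableSpace X] {μ : Measure X} [NormedAddCommGroup E]
  [NormedAddCommGroup F] [NormedAddCommGroup G] {p q : ℝ≥0∞}

lemma tendsto_eLpNorm_comp_sub_of_lipschitzWith {ι : Type*} {l : Filter ι} {K : ℝ≥0} {h : E → F}
    (hh : LipschitzWith K h) {f : ι → X → E} {f₀ : X → E}
    (hf : Tendsto (fun i ↦ eLpNorm (f i - f₀) p μ) l (𝓝 0)) :
    Tendsto (fun i ↦ eLpNorm (h ∘ f i - h ∘ f₀) p μ) l (𝓝 0) := by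
  have h_le (i : ι) : eLpNorm (h ∘ f i - h ∘ f₀) p μ ≤ K * eLpNorm (f i - f₀) p μ := by
    refine eLpNorm_le_nnreal_smul_eLpNorm_of_ae_le_mul (.of_forall fun x ↦ ?_) p
    simpa [← nndist_eq_nnnorm] using hh.nndist_le (f i x) (f₀ x)
  have h_lim := ENNReal.Tendsto.const_mul hf (.inr (ENNReal.coe_ne_top (r := K)))
  rw [mul_zero] at h_lim
  exact tendsto_of_tendsto_of_tendsto_of_le_of_le tendsto_const_nhds h_lim
    (fun _ ↦ zero_le) h_le

variable [NormedSpace ℝ E] [NormedSpace ℝ F] [NormedSpace ℝ G]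

lemma tendsto_integral_bilin_of_tendsto_eLpNorm [q.HolderConjugate p] (B : E →L[ℝ] F →L[ℝ] G)
    {f : ℕ → X → E} {f₀ : X → E} {g : ℕ → X → F} {g₀ : X → F} {b : X → ℝ}
    (hf : ∀ n, MemLp (f n) p μ) (hf₀ : MemLp f₀ p μ) (hg : ∀ n, AEStronglyMeasurable (g n) μ)
    (hb : MemLp b q μ) (hgb : ∀ n, ∀ᵐ x ∂μ, ‖g n x‖ ≤ b x)
    (h_lim : Tendsto (fun n ↦ eLpNorm (f n - f₀) p μ) atTop (𝓝 0))
    (hg_lim : ∀ᵐ x ∂μ, Tendsto (fun n ↦ g n x) atTop (𝓝 (g₀ x))) :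
    Tendsto (fun n ↦ ∫ x, B (f n x) (g n x) ∂μ) atTop (𝓝 (∫ x, B (f₀ x) (g₀ x) ∂μ)) := by
  have hgq (n : ℕ) : MemLp (g n) q μ := hb.mono' (hg n) (hgb n)
  have h_strong : Tendsto (fun n ↦ ∫ x, B ((f n - f₀) x) (g n x) ∂μ) atTop (𝓝 0) := by
    rw [tendsto_zero_iff_enorm_tendsto_zero]
    have h_bound := ENNReal.Tendsto.mul_const
      (ENNReal.Tendsto.const_mul h_lim (.inr (ENNReal.coe_ne_top (r := ‖B‖₊))))
      (.inr hb.eLpNorm_ne_top)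
    rw [mul_zero, zero_mul] at h_bound
    refine tendsto_of_tendsto_of_tendsto_of_le_of_le tendsto_const_nhds h_bound
      (fun _ ↦ zero_le) fun n ↦ ?_
    calc ‖∫ x, B ((f n - f₀) x) (g n x) ∂μ‖ₑ
        ≤ eLpNorm (fun x ↦ B ((f n - f₀) x) (g n x)) 1 μ := by
          rw [eLpNorm_one_eq_lintegral_enorm]
          exact enorm_integral_le_lintegral_enorm _
      _ ≤ ‖B‖₊ * eLpNorm (f n - f₀) p μ * eLpNorm (g n) q μ :=
          eLpNorm_le_eLpNorm_mul_eLpNorm_of_nnnorm ((hf n).sub hf₀).1 (hg n) (B · ·) _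
            (.of_forall fun x ↦ B.le_opNorm₂ _ _)
      _ ≤ ‖B‖₊ * eLpNorm (f n - f₀) p μ * eLpNorm b q μ := by
          gcongr
          exact eLpNorm_mono_ae_real (hgb n)
  have h_dom : Tendsto (fun n ↦ ∫ x, B (f₀ x) (g n x) ∂μ) atTop (𝓝 (∫ x, B (f₀ x) (g₀ x) ∂μ)) := by
    refine tendsto_integral_of_dominated_convergence (fun x ↦ ‖B‖ * (‖f₀ x‖ * b x))
      (fun n ↦ B.aestronglyMeasurable_comp₂ hf₀.1 (hg n))
      ((hf₀.norm.integrable_mul hb).const_mul _) (fun n ↦ ?_) ?_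
    · filter_upwards [hgb n] with x hx
      rw [← mul_assoc]
      exact B.le_of_opNorm₂_le_of_le le_rfl le_rfl hx
    · filter_upwards [hg_lim] with x hx
      exact ((B (f₀ x)).continuous.tendsto _).comp hx
  have h_add := h_strong.add h_dom
  rw [zero_add] at h_add
  refine h_add.congr fun n ↦ ?_
  rw [← integral_add (memLp_one_iff_integrable.1 (B.memLp_of_bilin 1 ((hf n).sub hf₀) (hgq n)))
    (memLp_one_iff_integrable.1 (B.memLp_of_bilin 1 hf₀ (hgq n)))]
  simp only [Pi.sub_apply, map_sub, sub_apply, sub_add_cancel]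

end Convergence

section ChainRule

variable {N : ℕ} {p : ℝ} [Fact (1 < p)] {Ω : Set (EuclideanSpace ℝ (Fin N))}

lemma hasWeakGradient_comp (u : sobolevZero N p Ω) {F : ℝ → ℝ} (hF : ContDiff ℝ 1 F)
    (hF0 : F 0 = 0) {K : ℝ≥0} (hK : ∀ y, ‖deriv F y‖₊ ≤ K) :
    HasWeakGradient Ω (F ∘ u.1.1) (fun x ↦ deriv F (u.1.1 x) • u.1.2 x) := by
  intro ψ hψ
  obtain ⟨φ, hφ, h_fst, h_grad, h_ae⟩ := exists_seq_isTestFunction_tendsto u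
  have hF_lip : LipschitzWith K F :=
    lipschitzWith_of_nnnorm_deriv_le (hF.differentiable one_ne_zero) hK
  have hF' : Continuous (deriv F) := hF.continuous_deriv_one
  have hφ₁ (n : ℕ) : ContDiff ℝ 1 (φ n) := (hφ n).contDiff.of_le (by simp)
  let q := ENNReal.conjExponent (.ofReal p)
  have h_lhs : Tendsto (fun n ↦ ∫ x in Ω, F (φ n x) • gradient ψ x) atTop
      (𝓝 (∫ x in Ω, F (u.1.1 x) • gradient ψ x)) :=
    tendsto_integral_bilin_of_tendsto_eLpNorm (q := q) (.lsmul ℝ ℝ)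
      (fun n ↦ hF_lip.comp_memLp hF0 ((hφ n).memLp (.ofReal p)))
      (hF_lip.comp_memLp hF0 (Lp.memLp u.1.1))
      (fun _ ↦ hψ.continuous_gradient.aestronglyMeasurable) (hψ.memLp_gradient q).norm
      (fun _ ↦ .of_forall fun _ ↦ le_rfl) (tendsto_eLpNorm_comp_sub_of_lipschitzWith hF_lip h_fst)
      (.of_forall fun _ ↦ tendsto_const_nhds)
  have h_rhs : Tendsto (fun n ↦ ∫ x in Ω, (ψ x * deriv F (φ n x)) • gradient (φ n) x) atTop
      (𝓝 (∫ x in Ω, (ψ x * deriv F (u.1.1 x)) • u.1.2 x)) :=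
    tendsto_integral_bilin_of_tendsto_eLpNorm (q := q)
      (ContinuousLinearMap.lsmul ℝ ℝ (E := EuclideanSpace ℝ (Fin N))).flip
      (fun n ↦ (hφ n).memLp_gradient (.ofReal p)) (Lp.memLp u.1.2)
      (fun n ↦ (hψ.continuous.mul (hF'.comp (hφ n).continuous)).aestronglyMeasurable)
      ((hψ.memLp q).norm.mul_const K)
      (fun n ↦ .of_forall fun x ↦ by rw [norm_mul]; gcongr; exact hK _) h_grad
      (h_ae.mono fun x hx ↦ ((hF'.tendsto _).comp hx).const_mul _)
  refine tendsto_nhds_unique h_lhs ?_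
  simp only [smul_smul]
  refine h_rhs.neg.congr fun n ↦ ?_
  have h_parts := hasWeakGradient_gradient (Ω := Ω) (hF.comp (hφ₁ n)) ψ hψ
  simp only [gradient_comp (hF.differentiable one_ne_zero _)
    ((hφ₁ n).differentiable one_ne_zero _), smul_smul] at h_parts
  exact h_parts.symm

-- The proof applies the chain rule to `F = sin (2π · / c)`, which vanishes at the values of `u`
-- while its derivative does not.
lemma snd_eq_zero_of_eq_zero_or_abs_eq (hΩ : IsOpen Ω) {u : sobolevZero N p Ω} {c : ℝ}
    (hc : 0 < c) (hu : ∀ᵐ x ∂volume.restrict Ω, u.1.1 x = 0 ∨ |u.1.1 x| = c) : u.1.2 = 0 := by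
  set κ := 2 * Real.pi / c
  have hκ : κ ≠ 0 := by positivity
  have hκ_mul : κ * c = 2 * Real.pi := div_mul_cancel₀ _ hc.ne'
  have hF (y : ℝ) : HasDerivAt (fun y ↦ Real.sin (κ * y)) (Real.cos (κ * y) * κ) y := by
    simpa using ((hasDerivAt_id y).const_mul κ).sin
  have h_val : ∀ᵐ x ∂volume.restrict Ω, Real.cos (κ * u.1.1 x) = 1 := by
    filter_upwards [hu] with x hx
    rcases hx with hx | hx
    · rw [hx, mul_zero, Real.cos_zero]
    · rw [← Real.cos_abs, abs_mul, hx, abs_of_nonneg (by positivity), hκ_mul, Real.cos_two_pi]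
  have h_sin : (fun y ↦ Real.sin (κ * y)) ∘ u.1.1 =ᵐ[volume.restrict Ω] 0 :=
    h_val.mono fun x hx ↦ Real.sin_eq_zero_iff_cos_eq.2 (.inl hx)
  have h_grad : (fun x ↦ deriv (fun y ↦ Real.sin (κ * y)) (u.1.1 x) • u.1.2 x)
      =ᵐ[volume.restrict Ω] fun x ↦ κ • u.1.2 x :=
    h_val.mono fun x hx ↦ by simp only [(hF _).deriv, hx, one_mul]
  have h_chain := hasWeakGradient_comp u (F := fun y ↦ Real.sin (κ * y)) (K := ‖κ‖₊)
    (by fun_prop) (by simp) fun y ↦ by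
      rw [(hF y).deriv, nnnorm_mul]
      exact mul_le_of_le_one_left' (Real.abs_cos_le_one _)
  have h_loc : LocallyIntegrable (fun x ↦ κ • u.1.2 x) (volume.restrict Ω) :=
    ((Lp.memLp u.1.2).locallyIntegrable Fact.out).smul κ
  refine (Lp.eq_zero_iff_ae_eq_zero).2 ?_
  filter_upwards [h_grad, h_chain.ae_eq_zero hΩ (h_loc.congr h_grad.symm) h_sin] with x h₁ h₂
  exact (smul_eq_zero_iff_right hκ).1 (h₁.symm.trans h₂)

end ChainRule

section AbsRpow

lemma abs_abs_rpow_sub_abs_rpow_le {s K x y : ℝ} (hs : 1 ≤ s) (hx : |x| ≤ K) (hy : |y| ≤ K) :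
    |(|x| ^ s - |y| ^ s)| ≤ s * K ^ (s - 1) * |x - y| := by
  have h_rpow : |(|x| ^ s - |y| ^ s)| ≤ s * K ^ (s - 1) * |(|x| - |y|)| := by
    refine (convex_Icc 0 K).norm_image_sub_le_of_norm_hasDerivWithin_le
      (f := fun z ↦ z ^ s) (f' := fun z ↦ s * z ^ (s - 1))
      (fun z _ ↦ (Real.hasDerivAt_rpow_const (.inr hs)).hasDerivWithinAt) (fun z hz ↦ ?_)
      ⟨abs_nonneg y, hy⟩ ⟨abs_nonneg x, hx⟩
    rw [norm_mul, Real.norm_of_nonneg (zero_le_one.trans hs),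
      Real.norm_of_nonneg (Real.rpow_nonneg hz.1 _)]
    gcongr
    exacts [hz.1, hz.2]
  have hK : 0 ≤ K := (abs_nonneg x).trans hx
  exact h_rpow.trans (mul_le_mul_of_nonneg_left (abs_abs_sub_abs_le x y) (by positivity))

lemma lipschitzOnWith_abs_add_mul_rpow {s : ℝ} (hs : 1 ≤ s) (x y : ℝ) :
    LipschitzOnWith (Real.nnabs (s * (|x| + |y|) ^ s)) (fun t ↦ |x + t * y| ^ s)
      (Set.Icc (-1) 1) := by
  have h_le {t : ℝ} (ht : t ∈ Set.Icc (-1) 1) : |x + t * y| ≤ |x| + |y| := by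
    refine (abs_add_le _ _).trans (add_le_add_right ?_ _)
    rw [abs_mul]
    exact mul_le_of_le_one_left (abs_nonneg y) (abs_le.2 ht)
  refine LipschitzOnWith.of_dist_le_mul fun t ht t' ht' ↦ ?_
  have h_const : 0 ≤ s * (|x| + |y|) ^ s := by positivity
  rw [Real.dist_eq, Real.dist_eq, Real.coe_nnabs, abs_of_nonneg h_const]
  calc |(|x + t * y| ^ s - |x + t' * y| ^ s)|
      ≤ s * (|x| + |y|) ^ (s - 1) * |x + t * y - (x + t' * y)| :=
        abs_abs_rpow_sub_abs_rpow_le hs (h_le ht) (h_le ht')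
    _ = s * ((|x| + |y|) ^ (s - 1) * |y|) * |t - t'| := by
        rw [add_sub_add_left_eq_sub, ← sub_mul, abs_mul]
        ring
    _ ≤ s * ((|x| + |y|) ^ (s - 1) * (|x| + |y|)) * |t - t'| := by
        gcongr
        exact le_add_of_nonneg_left (abs_nonneg x)
    _ = s * (|x| + |y|) ^ s * |t - t'| := by
        rw [← Real.rpow_add_one' (by positivity) (by linarith), sub_add_cancel]

lemma hasDerivAt_abs_rpow_of_ne_zero {s x : ℝ} (hx : x ≠ 0) :
    HasDerivAt (fun y ↦ |y| ^ s) (s * |x| ^ (s - 2) * x) x := by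
  have hx' : |x| ≠ 0 := abs_ne_zero.2 hx
  refine ((hasDerivAt_abs hx).rpow_const (p := s) (.inl hx')).congr_deriv ?_
  rw [show s - 1 = s - 2 + 1 by ring, Real.rpow_add_one hx']
  linear_combination (s * |x| ^ (s - 2)) * sign_mul_abs x

lemma hasDerivAt_abs_add_mul_rpow {s x : ℝ} (h : 1 < s ∨ x ≠ 0) (y : ℝ) :
    HasDerivAt (fun t ↦ |x + t * y| ^ s) (s * (|x| ^ (s - 2) * x * y)) 0 := by
  have h_abs : HasDerivAt (fun y ↦ |y| ^ s) (s * |x| ^ (s - 2) * x) x :=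
    h.elim (hasDerivAt_abs_rpow x) hasDerivAt_abs_rpow_of_ne_zero
  have h_line : HasDerivAt (fun t ↦ x + t * y) y 0 := (hasDerivAt_mul_const y).const_add x
  exact (h_abs.comp_of_eq 0 h_line (by simp)).congr_deriv (by ring)

lemma abs_eq_rpow_inv_of_abs_rpow_mul_div_eq {q r A B x : ℝ} (hqr : q < r) (hA : 0 < A)
    (hB : 0 < B) (hx : x ≠ 0) (h : |x| ^ (q - 2) * x / A = |x| ^ (r - 2) * x / B) :
    |x| = (B / A) ^ (r - q)⁻¹ := by
  have hx' : 0 < |x| := abs_pos.2 hx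
  have h_split : |x| ^ (r - 2) = |x| ^ (q - 2) * |x| ^ (r - q) := by
    rw [← Real.rpow_add hx']
    ring_nf
  have h_pow : |x| ^ (r - q) = B / A := by
    rw [h_split] at h
    field_simp at h ⊢
    exact h.symm
  rw [← h_pow, Real.rpow_rpow_inv hx'.le (sub_pos.2 hqr).ne']

end AbsRpow

section Integral

variable {X : Type*} [MeasurableSpace X] {μ : Measure X} {s : ℝ} {f g : X → ℝ}

lemma integrable_norm_rpow_ofReal {E : Type*} [NormedAddCommGroup E] {f : X → E} (hs : 0 < s)
    (hf : MemLp f (.ofReal s) μ) : Integrable (fun x ↦ ‖f x‖ ^ s) μ := by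
  simpa only [ENNReal.toReal_ofReal hs.le] using
    hf.integrable_norm_rpow (ENNReal.ofReal_pos.2 hs).ne' ENNReal.ofReal_ne_top

lemma integral_norm_rpow_pos {E : Type*} [NormedAddCommGroup E] {f : X → E} (hs : 0 < s)
    (hf : MemLp f (.ofReal s) μ) (hf0 : ¬ f =ᵐ[μ] 0) : 0 < ∫ x, ‖f x‖ ^ s ∂μ := by
  refine (integral_nonneg fun x ↦ by positivity).lt_of_ne' fun h ↦ hf0 ?_
  rw [integral_eq_zero_iff_of_nonneg (fun x ↦ by positivity)
    (integrable_norm_rpow_ofReal hs hf)] at h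
  exact h.mono fun x hx ↦ norm_eq_zero.1 ((Real.rpow_eq_zero (norm_nonneg _) hs.ne').1 hx)

lemma integrable_abs_add_abs_rpow (hs : 0 < s) (hf : MemLp f (.ofReal s) μ)
    (hg : MemLp g (.ofReal s) μ) : Integrable (fun x ↦ (|f x| + |g x|) ^ s) μ :=
  (integrable_norm_rpow_ofReal hs (hf.abs.add hg.abs)).congr <| .of_forall fun x ↦ by
    simp only [Pi.add_apply, Pi.abs_apply,
      Real.norm_of_nonneg (add_nonneg (abs_nonneg (f x)) (abs_nonneg (g x)))]

lemma integrable_abs_add_mul_rpow (hs : 0 < s) (hf : MemLp f (.ofReal s) μ)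
    (hg : MemLp g (.ofReal s) μ) (t : ℝ) : Integrable (fun x ↦ |f x + t * g x| ^ s) μ :=
  integrable_norm_rpow_ofReal hs (hf.add (hg.const_mul t))

lemma integrable_abs_rpow_mul_mul (hs : 1 ≤ s) (hf : MemLp f (.ofReal s) μ)
    (hg : MemLp g (.ofReal s) μ) : Integrable (fun x ↦ |f x| ^ (s - 2) * f x * g x) μ := by
  refine (integrable_abs_add_abs_rpow (zero_lt_one.trans_le hs) hf hg).mono'
    (((hf.1.aemeasurable.abs.pow_const (s - 2)).mul hf.1.aemeasurable).mul
      hg.1.aemeasurable).aestronglyMeasurable (.of_forall fun x ↦ ?_)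
  rcases eq_or_ne (f x) 0 with hx | hx
  · simp only [hx, mul_zero, zero_mul, norm_zero]
    positivity
  · have hx' : 0 < |f x| := abs_pos.2 hx
    calc ‖|f x| ^ (s - 2) * f x * g x‖
        = |f x| ^ (s - 1) * |g x| := by
          rw [norm_mul, norm_mul, Real.norm_of_nonneg (by positivity), Real.norm_eq_abs,
            Real.norm_eq_abs, ← Real.rpow_add_one hx'.ne']
          ring_nf
      _ ≤ (|f x| + |g x|) ^ (s - 1) * (|f x| + |g x|) := by
          gcongr
          exacts [le_add_of_nonneg_right (abs_nonneg _), le_add_of_nonneg_left (abs_nonneg _)]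
      _ = (|f x| + |g x|) ^ s := by
          rw [← Real.rpow_add_one (by positivity), sub_add_cancel]

lemma hasDerivAt_integral_abs_add_mul_rpow (hs : 1 ≤ s) (hf : MemLp f (.ofReal s) μ)
    (hg : MemLp g (.ofReal s) μ) (h : ∀ᵐ x ∂μ, 1 < s ∨ f x ≠ 0) :
    HasDerivAt (fun t ↦ ∫ x, |f x + t * g x| ^ s ∂μ)
      (s * ∫ x, |f x| ^ (s - 2) * f x * g x ∂μ) 0 := by
  have hs0 : 0 < s := zero_lt_one.trans_le hs
  have h_int := integrable_abs_add_mul_rpow hs0 hf hg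
  rw [← integral_const_mul]
  exact (hasDerivAt_integral_of_dominated_loc_of_lip (Icc_mem_nhds (by norm_num) one_pos)
    (.of_forall fun t ↦ (h_int t).aestronglyMeasurable) (h_int 0)
    ((integrable_abs_rpow_mul_mul hs hf hg).const_mul s).aestronglyMeasurable
    (.of_forall fun x ↦ lipschitzOnWith_abs_add_mul_rpow hs (f x) (g x))
    ((integrable_abs_add_abs_rpow hs0 hf hg).const_mul s)
    (h.mono fun x hx ↦ hasDerivAt_abs_add_mul_rpow hx (g x))).2

lemma eq_zero_of_hasDerivAt_of_even {β : ℝ → ℝ} {c : ℝ} (hβ : HasDerivAt β c 0)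
    (h_even : Function.Even β) : c = 0 := by
  have h_neg := hβ.comp_of_eq 0 (hasDerivAt_neg 0) neg_zero.symm
  have h_eq : c * -1 = c := h_neg.unique (hβ.congr_of_eventuallyEq (.of_forall h_even))
  linarith

-- For `s = 1` the integrand has a kink at `t = 0` wherever `f = 0`, but the contribution of these
-- points is even in `t`.
lemma eq_of_hasDerivAt_integral_abs_add_mul_rpow {c : ℝ} (hs : 1 ≤ s)
    (hf : MemLp f (.ofReal s) μ) (hg : MemLp g (.ofReal s) μ)
    (h : HasDerivAt (fun t ↦ ∫ x, |f x + t * g x| ^ s ∂μ) c 0) :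
    c = s * ∫ x, |f x| ^ (s - 2) * f x * g x ∂μ := by
  set S := {x | f x ≠ 0}
  have hS : NullMeasurableSet S μ :=
    hf.1.aemeasurable.nullMeasurable (measurableSet_singleton 0).compl
  have h_nonzero := hasDerivAt_integral_abs_add_mul_rpow hs (hf.restrict S) (hg.restrict S)
    ((ae_restrict_mem₀ hS).mono fun x hx ↦ .inr hx)
  rw [setIntegral_eq_integral_of_forall_compl_eq_zero
    fun x hx ↦ by rw [not_not.1 hx, mul_zero, zero_mul]] at h_nonzero
  have h_zero (t : ℝ) : ∫ x, |f x + t * g x| ^ s ∂μ - ∫ x in S, |f x + t * g x| ^ s ∂μ =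
      ∫ x in Sᶜ, |t * g x| ^ s ∂μ := by
    rw [← integral_add_compl₀ hS (integrable_abs_add_mul_rpow (zero_lt_one.trans_le hs) hf hg t),
      add_sub_cancel_left]
    refine integral_congr_ae ?_
    filter_upwards [ae_restrict_mem₀ hS.compl] with x hx
    rw [not_not.1 hx, zero_add]
  refine sub_eq_zero.1 (eq_zero_of_hasDerivAt_of_even (h.sub h_nonzero) fun t ↦ ?_)
  rw [Pi.sub_apply, Pi.sub_apply, h_zero, h_zero]
  simp only [neg_mul, abs_neg]

end Integral

lemma hasDerivAt_of_hasDerivAt_log_div_sub_log_div {q r b' t₀ : ℝ} {a b : ℝ → ℝ} (hq : q ≠ 0)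
    (ha : ∀ᶠ t in 𝓝 t₀, 0 < a t) (hb₀ : 0 < b t₀) (hb : HasDerivAt b b' t₀)
    (h : HasDerivAt (fun t ↦ Real.log (a t) / q - Real.log (b t) / r) 0 t₀) :
    HasDerivAt a (q * a t₀ * (b' / (r * b t₀))) t₀ := by
  set ρ := fun t ↦ Real.log (a t) / q - Real.log (b t) / r with hρ
  have h_exp : a =ᶠ[𝓝 t₀] fun t ↦ Real.exp (q * (ρ t + Real.log (b t) / r)) := by
    filter_upwards [ha] with t ht
    rw [hρ, sub_add_cancel, mul_div_cancel₀ _ hq, Real.exp_log ht]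
  have h_deriv := ((h.add ((hb.log hb₀.ne').div_const r)).const_mul q).exp
  refine (h_deriv.congr_of_eventuallyEq h_exp).congr_deriv ?_
  rw [h_exp.eq_of_nhds, Pi.add_apply, div_div, mul_comm (b t₀)]
  ring

section RayleighQuotient

variable {N : ℕ} {p : ℝ} [Fact (1 < p)] {Ω : Set (EuclideanSpace ℝ (Fin N))}
  {u : sobolevZero N p Ω} {q r s α α₁ α₂ : ℝ}

lemma integral_abs_add_smul_rpow (u w : sobolevZero N p Ω) (s t : ℝ) :
    ∫ x in Ω, |(u + t • w).1.1 x| ^ s = ∫ x in Ω, |u.1.1 x + t * w.1.1 x| ^ s := by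
  refine integral_congr_ae ?_
  filter_upwards [Lp.coeFn_add u.1.1 (t • w.1.1), Lp.coeFn_smul t w.1.1] with x h_add h_smul
  have h_val : (u + t • w).1.1 x = u.1.1 x + t * w.1.1 x :=
    h_add.trans (congrArg (u.1.1 x + ·) h_smul)
  simp only [h_val]

lemma snd_ne_zero (hN : 0 < N) (hΩ : volume Ω ≠ ⊤) (hu : u ≠ 0) : u.1.2 ≠ 0 :=
  fun h ↦ hu (eq_zero_of_snd_eq_zero hN hΩ h)

lemma integral_norm_snd_rpow_pos (hN : 0 < N) (hΩ : volume Ω ≠ ⊤) (hu : u ≠ 0) :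
    0 < ∫ x in Ω, ‖u.1.2 x‖ ^ p :=
  integral_norm_rpow_pos (zero_lt_one.trans Fact.out) (Lp.memLp u.1.2)
    fun h ↦ snd_ne_zero hN hΩ hu (Lp.eq_zero_iff_ae_eq_zero.2 h)

lemma integral_abs_fst_rpow_pos (hN : 0 < N) (hs₀ : 0 < s) (hs : p < N → s ≤ N * p / (N - p))
    (hΩo : IsOpen Ω) (hΩ : volume Ω ≠ ⊤) (hu : u ≠ 0) : 0 < ∫ x in Ω, |u.1.1 x| ^ s :=
  integral_norm_rpow_pos hs₀ (memLp_fst hN hs₀ hs hΩ u) fun h ↦ snd_ne_zero hN hΩ hu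
    (snd_eq_zero_of_eq_zero_or_abs_eq hΩo one_pos (h.mono fun _ ↦ .inl))

/-- The functional `log (‖u‖_q / ‖u‖_r)`. Up to a constant factor it is the difference of the
logarithms of any two Rayleigh quotients `R_α`, so it inherits their common critical points. -/
noncomputable def logNormRatio (q r : ℝ) (u : sobolevZero N p Ω) : ℝ :=
  Real.log (∫ x in Ω, |u.1.1 x| ^ q) / q - Real.log (∫ x in Ω, |u.1.1 x| ^ r) / r

lemma log_rayleighQuotient (hG : 0 < ∫ x in Ω, ‖u.1.2 x‖ ^ p)
    (hA : 0 < ∫ x in Ω, |u.1.1 x| ^ q) (hB : 0 < ∫ x in Ω, |u.1.1 x| ^ r) (α : ℝ) :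
    Real.log (rayleighQuotient q r α u) = Real.log (∫ x in Ω, ‖u.1.2 x‖ ^ p) -
      p / r * Real.log (∫ x in Ω, |u.1.1 x| ^ r) - α * p * logNormRatio q r u := by
  rw [rayleighQuotient, Real.log_div hG.ne' (by positivity), Real.log_mul (by positivity)
    (by positivity), Real.log_rpow hA, Real.log_rpow hB, logNormRatio]
  ring

lemma rayleighQuotient_pos (hG : 0 < ∫ x in Ω, ‖u.1.2 x‖ ^ p)
    (hA : 0 < ∫ x in Ω, |u.1.1 x| ^ q) (hB : 0 < ∫ x in Ω, |u.1.1 x| ^ r) (α : ℝ) :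
    0 < rayleighQuotient q r α u := by
  rw [rayleighQuotient]
  positivity

lemma hasFDerivAt_logNormRatio_of_isCriticalPoint (hN : 0 < N) (hq : 0 < q) (hqr : q ≤ r)
    (hr : p < N → r ≤ N * p / (N - p)) (hΩo : IsOpen Ω) (hΩ : volume Ω ≠ ⊤) (hα : α₁ ≠ α₂)
    (h₁ : IsCriticalPoint q r α₁ u) (h₂ : IsCriticalPoint q r α₂ u) :
    HasFDerivAt (logNormRatio q r) (0 : sobolevZero N p Ω →L[ℝ] ℝ) u := by
  have hp : 0 < p := zero_lt_one.trans Fact.out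
  have hG {v : sobolevZero N p Ω} (hv : v ≠ 0) := integral_norm_snd_rpow_pos hN hΩ hv
  have hA {v : sobolevZero N p Ω} (hv : v ≠ 0) :=
    integral_abs_fst_rpow_pos hN hq (fun h ↦ hqr.trans (hr h)) hΩo hΩ hv
  have hB {v : sobolevZero N p Ω} (hv : v ≠ 0) :=
    integral_abs_fst_rpow_pos hN (hq.trans_le hqr) hr hΩo hΩ hv
  have h_log {α : ℝ} (h : IsCriticalPoint q r α u) :
      HasFDerivAt (fun v ↦ Real.log (rayleighQuotient q r α v))
        (0 : sobolevZero N p Ω →L[ℝ] ℝ) u := by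
    simpa only [smul_zero] using
      h.2.log (rayleighQuotient_pos (hG h.1) (hA h.1) (hB h.1) α).ne'
  have h_eq : logNormRatio q r =ᶠ[𝓝 u] fun v ↦ ((α₂ - α₁) * p)⁻¹ *
      (Real.log (rayleighQuotient q r α₁ v) - Real.log (rayleighQuotient q r α₂ v)) := by
    filter_upwards [eventually_ne_nhds h₁.1] with v hv
    rw [log_rayleighQuotient (hG hv) (hA hv) (hB hv), log_rayleighQuotient (hG hv) (hA hv) (hB hv),
      eq_inv_mul_iff_mul_eq₀ (mul_ne_zero (sub_ne_zero.2 hα.symm) hp.ne')]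
    ring
  have h_deriv := ((h_log h₁).sub (h_log h₂)).const_mul ((α₂ - α₁) * p)⁻¹
  rw [sub_zero, smul_zero] at h_deriv
  exact h_deriv.congr_of_eventuallyEq h_eq

lemma integral_mul_div_eq_of_hasFDerivAt_logNormRatio (hN : 0 < N) (hq : 1 ≤ q) (hqr : q < r)
    (hr : p < N → r ≤ N * p / (N - p)) (hΩo : IsOpen Ω) (hΩ : volume Ω ≠ ⊤) (hu : u ≠ 0)
    (h : HasFDerivAt (logNormRatio q r) (0 : sobolevZero N p Ω →L[ℝ] ℝ) u)
    (w : sobolevZero N p Ω) :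
    (∫ x in Ω, |u.1.1 x| ^ (q - 2) * u.1.1 x * w.1.1 x) / ∫ x in Ω, |u.1.1 x| ^ q =
      (∫ x in Ω, |u.1.1 x| ^ (r - 2) * u.1.1 x * w.1.1 x) / ∫ x in Ω, |u.1.1 x| ^ r := by
  have hq₀ : 0 < q := zero_lt_one.trans_le hq
  have hr₀ : 0 < r := hq₀.trans hqr
  have hq' (hpN : p < N) : q ≤ N * p / (N - p) := hqr.le.trans (hr hpN)
  have h_line : HasDerivAt (fun t : ℝ ↦ u + t • w) w 0 := by
    simpa using ((hasDerivAt_id (0 : ℝ)).smul_const w).const_add u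
  have h_line₀ : u + (0 : ℝ) • w = u := by rw [zero_smul, add_zero]
  have h_ne : ∀ᶠ t : ℝ in 𝓝 0, u + t • w ≠ 0 :=
    h_line.continuousAt.eventually_ne (by rwa [h_line₀])
  have h_ratio := h.comp_hasDerivAt_of_eq 0 h_line h_line₀.symm
  have h_deriv_r := hasDerivAt_integral_abs_add_mul_rpow (hq.trans hqr.le)
    (memLp_fst hN hr₀ hr hΩ u) (memLp_fst hN hr₀ hr hΩ w)
    (.of_forall fun _ ↦ .inl (hq.trans_lt hqr))
  simp only [← integral_abs_add_smul_rpow] at h_deriv_r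
  have hA := integral_abs_fst_rpow_pos hN hq₀ hq' hΩo hΩ hu
  have hB := integral_abs_fst_rpow_pos hN hr₀ hr hΩo hΩ hu
  have h_deriv_q := hasDerivAt_of_hasDerivAt_log_div_sub_log_div hq₀.ne'
    (h_ne.mono fun t ↦ integral_abs_fst_rpow_pos hN hq₀ hq' hΩo hΩ) (by rwa [h_line₀])
    h_deriv_r h_ratio
  simp only [integral_abs_add_smul_rpow u w q] at h_deriv_q
  have h_eq := eq_of_hasDerivAt_integral_abs_add_mul_rpow hq (memLp_fst hN hq₀ hq' hΩ u)
    (memLp_fst hN hq₀ hq' hΩ w) h_deriv_q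
  simp only [h_line₀, zero_mul, add_zero] at h_eq
  field_simp at h_eq ⊢
  linear_combination -h_eq

lemma abs_rpow_mul_div_ae_eq_of_hasFDerivAt_logNormRatio (hN : 0 < N) (hq : 1 ≤ q) (hqr : q < r)
    (hr : p < N → r ≤ N * p / (N - p)) (hΩo : IsOpen Ω) (hΩ : volume Ω ≠ ⊤) (hu : u ≠ 0)
    (h : HasFDerivAt (logNormRatio q r) (0 : sobolevZero N p Ω →L[ℝ] ℝ) u) :
    (fun x ↦ |u.1.1 x| ^ (q - 2) * u.1.1 x / ∫ x in Ω, |u.1.1 x| ^ q) =ᵐ[volume.restrict Ω]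
      fun x ↦ |u.1.1 x| ^ (r - 2) * u.1.1 x / ∫ x in Ω, |u.1.1 x| ^ r := by
  have : IsFiniteMeasure (volume.restrict Ω) := ⟨by simpa using hΩ.lt_top⟩
  have hur := memLp_fst hN (by linarith) hr hΩ u
  have huq := hur.mono_exponent (ENNReal.ofReal_le_ofReal hqr.le)
  have h_int {s : ℝ} (hs : 1 ≤ s) (hus : MemLp u.1.1 (.ofReal s) (volume.restrict Ω)) (c : ℝ) :
      Integrable (fun x ↦ |u.1.1 x| ^ (s - 2) * u.1.1 x / c) (volume.restrict Ω) := by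
    simpa using (integrable_abs_rpow_mul_mul hs hus (memLp_const 1)).div_const c
  set A := ∫ x in Ω, |u.1.1 x| ^ q
  set B := ∫ x in Ω, |u.1.1 x| ^ r
  refine (ae_eq_zero_of_forall_integral_smul_eq_zero hΩo
    ((h_int hq huq A).sub (h_int (hq.trans hqr.le) hur B)).locallyIntegrable fun ψ hψ ↦ ?_).mono
    fun x hx ↦ sub_eq_zero.1 hx
  obtain ⟨w, hw⟩ := hψ.exists_sobolevZero (p := p)
  have h_pair {s : ℝ} (c : ℝ) : ∫ x in Ω, |u.1.1 x| ^ (s - 2) * u.1.1 x * ψ x / c =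
      (∫ x in Ω, |u.1.1 x| ^ (s - 2) * u.1.1 x * w.1.1 x) / c := by
    rw [integral_div]
    exact congrArg (· / c) (integral_congr_ae (hw.mono fun x hx ↦ by simp only [hx]))
  calc ∫ x in Ω, ψ x • (|u.1.1 x| ^ (q - 2) * u.1.1 x / A - |u.1.1 x| ^ (r - 2) * u.1.1 x / B)
      = ∫ x in Ω, (|u.1.1 x| ^ (q - 2) * u.1.1 x * ψ x / A -
          |u.1.1 x| ^ (r - 2) * u.1.1 x * ψ x / B) := by
        congr with x
        rw [smul_eq_mul]
        ring
    _ = 0 := by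
        rw [integral_sub ((integrable_abs_rpow_mul_mul hq huq (hψ.memLp _)).div_const A)
            ((integrable_abs_rpow_mul_mul (hq.trans hqr.le) hur (hψ.memLp _)).div_const B),
          h_pair, h_pair, sub_eq_zero]
        exact integral_mul_div_eq_of_hasFDerivAt_logNormRatio hN hq hqr hr hΩo hΩ hu h w

lemma not_hasFDerivAt_logNormRatio (hN : 0 < N) (hq : 1 ≤ q) (hqr : q < r)
    (hr : p < N → r ≤ N * p / (N - p)) (hΩo : IsOpen Ω) (hΩ : volume Ω ≠ ⊤) (hu : u ≠ 0) :
    ¬ HasFDerivAt (logNormRatio q r) (0 : sobolevZero N p Ω →L[ℝ] ℝ) u := by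
  intro h
  have hA := integral_abs_fst_rpow_pos hN (by linarith) (fun h ↦ hqr.le.trans (hr h)) hΩo hΩ hu
  have hB := integral_abs_fst_rpow_pos hN (by linarith) hr hΩo hΩ hu
  refine snd_ne_zero hN hΩ hu (snd_eq_zero_of_eq_zero_or_abs_eq hΩo
    (Real.rpow_pos_of_pos (div_pos hB hA) (r - q)⁻¹) ?_)
  filter_upwards [abs_rpow_mul_div_ae_eq_of_hasFDerivAt_logNormRatio hN hq hqr hr hΩo hΩ hu h]
    with x hx
  exact or_iff_not_imp_left.2 fun hx₀ ↦ abs_eq_rpow_inv_of_abs_rpow_mul_div_eq hqr hA hB hx₀ hx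

lemma not_isCriticalPoint_and_isCriticalPoint (hN : 0 < N) (hq : 1 ≤ q) (hqr : q < r)
    (hr : p < N → r ≤ N * p / (N - p)) (hΩo : IsOpen Ω) (hΩ : volume Ω ≠ ⊤) (hα : α₁ ≠ α₂)
    (u : sobolevZero N p Ω) : ¬ (IsCriticalPoint q r α₁ u ∧ IsCriticalPoint q r α₂ u) :=
  fun ⟨h₁, h₂⟩ ↦ not_hasFDerivAt_logNormRatio hN hq hqr hr hΩo hΩ h₁.1
    (hasFDerivAt_logNormRatio_of_isCriticalPoint hN (by linarith) hqr.le hr hΩo hΩ hα h₁ h₂)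

lemma integral_abs_smul_rpow (k s : ℝ) (u : sobolevZero N p Ω) :
    ∫ x in Ω, |(k • u).1.1 x| ^ s = |k| ^ s * ∫ x in Ω, |u.1.1 x| ^ s := by
  rw [← integral_const_mul]
  refine integral_congr_ae ((Lp.coeFn_smul k u.1.1).mono fun x hx ↦ ?_)
  have h_val : (k • u).1.1 x = k * u.1.1 x := hx
  simp only [h_val, abs_mul, Real.mul_rpow (abs_nonneg _) (abs_nonneg _)]

lemma integral_norm_snd_smul_rpow (k s : ℝ) (u : sobolevZero N p Ω) :
    ∫ x in Ω, ‖(k • u).1.2 x‖ ^ s = |k| ^ s * ∫ x in Ω, ‖u.1.2 x‖ ^ s := by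
  rw [← integral_const_mul]
  refine integral_congr_ae ((Lp.coeFn_smul k u.1.2).mono fun x hx ↦ ?_)
  have h_val : (k • u).1.2 x = k • u.1.2 x := hx
  simp only [h_val, norm_smul, Real.norm_eq_abs, Real.mul_rpow (abs_nonneg _) (norm_nonneg _)]

lemma rayleighQuotient_smul (hq : q ≠ 0) (hr : r ≠ 0) (α : ℝ) {k : ℝ} (hk : k ≠ 0)
    (u : sobolevZero N p Ω) : rayleighQuotient q r α (k • u) = rayleighQuotient q r α u := by
  have hk' : 0 < |k| := abs_pos.2 hk
  have h_nonneg (s : ℝ) : 0 ≤ ∫ x in Ω, |u.1.1 x| ^ s := integral_nonneg fun x ↦ by positivity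
  have h_degree : q * (α * p / q) + r * ((1 - α) * p / r) = p := by
    field_simp
    ring
  simp only [rayleighQuotient, integral_abs_smul_rpow, integral_norm_snd_smul_rpow]
  rw [Real.mul_rpow (by positivity) (h_nonneg q), Real.mul_rpow (by positivity) (h_nonneg r),
    ← Real.rpow_mul hk'.le, ← Real.rpow_mul hk'.le, mul_mul_mul_comm, ← Real.rpow_add hk',
    h_degree, mul_div_mul_left _ _ (Real.rpow_pos_of_pos hk' p).ne']

lemma IsCriticalPoint.smul (hq : q ≠ 0) (hr : r ≠ 0) {k : ℝ} (hk : k ≠ 0)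
    (hu : IsCriticalPoint q r α u) : IsCriticalPoint q r α (k • u) := by
  refine ⟨smul_ne_zero hk hu.1, ?_⟩
  have h_comp : rayleighQuotient q r α ∘ (fun v : sobolevZero N p Ω ↦ k⁻¹ • v) =
      rayleighQuotient q r α := funext (rayleighQuotient_smul hq hr α (inv_ne_zero hk))
  have h_inv : k⁻¹ • k • u = u := inv_smul_smul₀ hk u
  have h_deriv := (h_inv.symm ▸ hu.2).comp (k • u) ((hasFDerivAt_id (k • u)).const_smul k⁻¹)
  rwa [ContinuousLinearMap.zero_comp, h_comp] at h_deriv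

end RayleighQuotient

end Rayleigh

theorem mainTheorem12_general (N : ℕ) (hN : 1 ≤ N) (p q r : ℝ) [Fact (1 < p)]
    (hq : 1 ≤ q) (hqr : q < r) (hr : p < N → r ≤ N * p / (N - p))
    (Ω : Set (EuclideanSpace ℝ (Fin N))) (hΩ : IsOpen Ω) (hΩ_fin : volume Ω ≠ ⊤)
    (α₁ α₂ : ℝ) (hα : α₁ ≠ α₂) :
    (∀ u : Rayleigh.sobolevZero N p Ω,
      ¬ (Rayleigh.IsCriticalPoint q r α₁ u ∧ Rayleigh.IsCriticalPoint q r α₂ u)) ∧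
    (∀ u₁ u₂ : Rayleigh.sobolevZero N p Ω,
      Rayleigh.IsCriticalPoint q r α₁ u₁ → Rayleigh.IsCriticalPoint q r α₂ u₂ →
        LinearIndependent ℝ ![u₁, u₂]) := by
  have h_main := Rayleigh.not_isCriticalPoint_and_isCriticalPoint (p := p) hN hq hqr hr hΩ hΩ_fin hα
  refine ⟨h_main, fun u₁ u₂ h₁ h₂ ↦ (LinearIndependent.pair_iff' h₁.1).2 fun k hk ↦ ?_⟩
  have hk₀ : k ≠ 0 := by
    rintro rfl
    exact h₂.1 (by rw [← hk, zero_smul])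
  exact h_main u₂ ⟨hk ▸ h₁.smul (by linarith) (by linarith) hk₀, h₂⟩

theorem mainTheorem12 (N : ℕ) (hN : 1 ≤ N) (p q r : ℝ) [Fact (1 < p)]
    (hq : 1 ≤ q) (hqr : q < r) (hr : p < N → r < N * p / (N - p))
    (Ω : Set (EuclideanSpace ℝ (Fin N))) (hΩ : IsOpen Ω) (hΩb : Bornology.IsBounded Ω)
    (α₁ α₂ : ℝ) (hα : α₁ ≠ α₂) :
    (∀ u : Rayleigh.sobolevZero N p Ω,
      ¬ (Rayleigh.IsCriticalPoint q r α₁ u ∧ Rayleigh.IsCriticalPoint q r α₂ u)) ∧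
    (∀ u₁ u₂ : Rayleigh.sobolevZero N p Ω,
      Rayleigh.IsCriticalPoint q r α₁ u₁ → Rayleigh.IsCriticalPoint q r α₂ u₂ →
        LinearIndependent ℝ ![u₁, u₂]) :=
  mainTheorem12_general N hN p q r hq hqr (fun h ↦ (hr h).le) Ω hΩ hΩb.measure_lt_top.ne α₁ α₂ hα
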